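/- For a sequence $\bar m=(m_1,m_2,\dots)$ of positive integers let $T_{\bar m}$ be the locally finite rooted tree in which every vertex at distance $n$ from the root has exactly $m_{n+1}$ children, and let $\mathrm{Iso}(T_{\bar m})$ be the group of all isometries of $T_{\bar m}$ fixing the root, with its profinite topology (pointwise convergence on vertices). A representation of a profinite group $G$ on $T_{\bar m}$ is a continuous homomorphism $\rho\colon G\to \mathrm{Iso}(T_{\bar m})$; it has a small number of isometry types if $\rho(G)$ meets fewer than $2^{\aleph_0}$ conjugacy classes of $\mathrm{Iso}(T_{\bar m})$. A profinite group has finite rank if there is an integer $r$ such that every closed subgroup is topologically generated by at most $r$ elements. Theorem. Let $G$ be a nilpotent profinite group. (a) If all representations of $G$ on the trees $T_{\bar m}$ (for all $\bar m$) have a small number of isometry types, then $G$ has finite rank. (b) If $G$ is second countable and all faithful representations of $G$ on the trees $T_{\bar m}$ (for all $\bar m$) have a small number of isometry types, then $G$ has finite rank. -/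

import Mathlib

/-! ### Spherically homogeneous rooted trees -/

/-- The vertices of the rooted tree given by `m`: a vertex of level `n` is a path
`(a 0, ..., a (n - 1))` from the root, where `a i` is one of `m i` letters. So
every vertex of level `i` has exactly `m i` children. -/
abbrev TreeVertex (m : ℕ → ℕ) : Type := Σ n : ℕ, ((i : Fin n) → Fin (m i))

/-- The root: the empty path. -/
def treeRoot (m : ℕ → ℕ) : TreeVertex m := ⟨0, fun i => i.elim0⟩

/-- `v` is a child of `u`: the path `v` extends the path `u` by one letter. -/
def IsChild (m : ℕ → ℕ) (u v : TreeVertex m) : Prop :=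
  ∃ a : Fin (m u.1), v = ⟨u.1 + 1, Fin.snoc (α := fun i : Fin (u.1 + 1) => Fin (m i)) u.2 a⟩

/-- The locally finite rooted tree given by `m`, as a graph: edges join each
vertex to its children. -/
def rootedTree (m : ℕ → ℕ) : SimpleGraph (TreeVertex m) := SimpleGraph.fromRel (IsChild m)

/-- The group of all isometries (that is, graph automorphisms) of the tree that fix the root. -/
def treeIso (m : ℕ → ℕ) : Subgroup (rootedTree m ≃g rootedTree m) where
  carrier := {g | g (treeRoot m) = treeRoot m}
  one_mem' := rfl
  mul_mem' {g h} hg hh := by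
    change g (h (treeRoot m)) = treeRoot m
    rw [show h (treeRoot m) = treeRoot m from hh]
    exact hg
  inv_mem' {g} hg := by
    change g.symm (treeRoot m) = treeRoot m
    exact g.symm_apply_eq.mpr (Eq.symm hg)

/-- The profinite topology of the isometry group: pointwise convergence on the discrete set of
vertices. As the levels are finite, the pointwise stabilizers of the balls about the root form
a base of neighbourhoods of the identity. -/
instance treeIsoTopology (m : ℕ → ℕ) : TopologicalSpace (treeIso m) :=
  TopologicalSpace.induced
    (fun (g : treeIso m) (v : TreeVertex m) => (g : rootedTree m ≃g rootedTree m) v)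
    (@Pi.topologicalSpace (TreeVertex m) (fun _ => TreeVertex m) (fun _ => ⊥))

/-- A subgroup `H` of `Γ` has a small number of types in `Γ` if it meets fewer than
`2 ^ ℵ₀` conjugacy classes of `Γ`. For `Γ = treeIso m` these are the isometry types. -/
def HasSmallNumberOfTypes {Γ : Type*} [Group Γ] (H : Subgroup Γ) : Prop :=
  Cardinal.mk {c : ConjClasses Γ | ∃ h ∈ H, ConjClasses.mk h = c} < Cardinal.continuum

/-- A topological group has finite rank if there is `r` such that every closed subgroup
is topologically generated by at most `r` elements. -/
def HasFiniteRank (G : Type*) [Group G] [TopologicalSpace G] [IsTopologicalGroup G] : Prop :=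
  ∃ r : ℕ, ∀ H : Subgroup G, IsClosed (H : Set G) →
    ∃ S : Finset G, S.card ≤ r ∧ (Subgroup.closure (S : Set G)).topologicalClosure = H

/-!
The theorem rests on two facts about a nilpotent profinite group `G`.

If `G` is not topologically finitely generated, then no open subgroup lies in all maximal open
subgroups, and so one can choose maximal open subgroups `H 0, H 1, …`, none of them containing the
intersection of the preceding ones (`exists_isCoatom_not_le`). They are normal since `G` is
nilpotent, and by compactness every set of natural numbers is of the form `{i | g ∈ H i}`
(`exists_independent_seq`). Let `G` act diagonally on the tree whose letters of level `i` are the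
cosets of `H i` and one additional fixed letter. An element `g` lies in `H i` exactly if it fixes
all neighbours of its fixed vertices of level `i`, which is a conjugacy invariant in the isometry
group (`exists_rep_of_seq`). Hence this representation has `2 ^ ℵ₀` isometry types. If `G` is second
countable, a sequence of open normal subgroups with trivial intersection can be interleaved with
the `H i`, which makes the representation faithful.

So `G` is topologically generated by a finite set. The abstract group generated by this set is
nilpotent, and a finitely generated nilpotent group has finite rank, by induction along the lower
central series (`Group.exists_hasRankLE_top_of_isNilpotent`). As this group is dense, all open
subgroups of `G` are topologically generated by a bounded number of elements, and by compactness so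
are all closed subgroups (`hasFiniteRank_of_topologicalClosure_eq_top`).
-/

/-! ### Finitely generated nilpotent groups have finite rank -/

/-- A subgroup `H` has rank at most `r` if each of its subgroups is generated by `r` elements,
repetitions being allowed. -/
def Subgroup.HasRankLE {Γ : Type*} [Group Γ] (H : Subgroup Γ) (r : ℕ) : Prop :=
  ∀ K ≤ H, ∃ f : Fin r → Γ, Subgroup.closure (Set.range f) = K

theorem Subgroup.hasRankLE_bot {Γ : Type*} [Group Γ] : (⊥ : Subgroup Γ).HasRankLE 0 := by
  intro K hK
  refine ⟨Fin.elim0, ?_⟩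
  rw [Set.range_eq_empty, Subgroup.closure_empty]
  exact (le_bot_iff.mp hK).symm

/-- Adjoining one element to a normal subgroup raises the rank by at most one: modulo `N` a
subgroup of `N ⊔ ⟨t⟩` is cyclic, so it is generated by one element and its intersection with
`N`. -/
theorem Subgroup.HasRankLE.sup_zpowers {Γ : Type*} [Group Γ] {N : Subgroup Γ} [N.Normal] {r : ℕ}
    (h : N.HasRankLE r) (t : Γ) : (N ⊔ Subgroup.zpowers t).HasRankLE (r + 1) := by
  intro K hK
  have hmap : K.map (QuotientGroup.mk' N) ≤ Subgroup.zpowers (QuotientGroup.mk' N t) := by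
    refine (Subgroup.map_mono hK).trans ?_
    rw [Subgroup.map_sup, MonoidHom.map_zpowers, QuotientGroup.map_mk'_self, bot_sup_eq]
  obtain ⟨n, hn⟩ := (Subgroup.le_zpowers_iff _ _).mp hmap
  obtain ⟨k, hkK, hk⟩ : QuotientGroup.mk' N t ^ n ∈ K.map (QuotientGroup.mk' N) := by
    rw [hn]; exact Subgroup.mem_zpowers _
  obtain ⟨f, hf⟩ := h (N ⊓ K) inf_le_left
  refine ⟨Fin.cons k f, ?_⟩
  rw [Fin.range_cons]
  apply le_antisymm
  · rw [Subgroup.closure_le, Set.insert_subset_iff]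
    refine ⟨hkK, fun x hx => ?_⟩
    have : x ∈ N ⊓ K := hf ▸ Subgroup.subset_closure hx
    exact this.2
  · intro y hy
    have hy' : QuotientGroup.mk' N y ∈ K.map (QuotientGroup.mk' N) :=
      Subgroup.mem_map_of_mem _ hy
    rw [hn, ← hk] at hy'
    obtain ⟨j, hj⟩ := Subgroup.mem_zpowers_iff.mp hy'
    have hN : (k ^ j)⁻¹ * y ∈ N ⊓ K := by
      refine ⟨?_, K.mul_mem (K.inv_mem (K.zpow_mem hkK j)) hy⟩
      rw [← map_zpow] at hj
      exact QuotientGroup.eq.mp hj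
    rw [← hf] at hN
    have h1 := Subgroup.closure_mono (Set.subset_insert k (Set.range f)) hN
    have h2 := Subgroup.zpow_mem _ (Subgroup.subset_closure (Set.mem_insert k (Set.range f))) j
    simpa using Subgroup.mul_mem _ h2 h1

open Subgroup commutatorElement in
/-- A subgroup between two consecutive terms of the lower central series is normal, being central
modulo the smaller term. -/
theorem Subgroup.normal_of_lowerCentralSeries_le {Γ : Type*} [Group Γ] {n : ℕ} {K : Subgroup Γ}
    (h₁ : (⊤ : Subgroup Γ).lowerCentralSeries (n + 1) ≤ K)
    (h₂ : K ≤ (⊤ : Subgroup Γ).lowerCentralSeries n) : K.Normal := by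
  refine ⟨fun x hx g => ?_⟩
  have : ⁅x, g⁆ ∈ K := h₁ (commutator_mem_commutator (h₂ hx) (mem_top g))
  have h3 : ⁅x, g⁆⁻¹ * x ∈ K := K.mul_mem (K.inv_mem this) hx
  have h4 : g * x * g⁻¹ = ⁅x, g⁆⁻¹ * x := by rw [commutatorElement_def]; group
  rwa [h4]

open Subgroup commutatorElement in
/-- In a finitely generated group, each term of the lower central series is finitely generated
modulo the next. If `T` generates the `n`-th term modulo the next one and `S` generates the group,
then the commutators `⁅t, s⁆` serve for the next term: modulo them the elements of `T` commute
with `S`, hence are central. -/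
theorem Subgroup.exists_finite_lowerCentralSeries_le {Γ : Type*} [Group Γ] [Group.FG Γ] (n : ℕ) :
    ∃ T : Set Γ, T.Finite ∧ T ⊆ ((⊤ : Subgroup Γ).lowerCentralSeries n : Set Γ) ∧
      (⊤ : Subgroup Γ).lowerCentralSeries n ≤
        closure T ⊔ (⊤ : Subgroup Γ).lowerCentralSeries (n + 1) := by
  obtain ⟨S, hS, hSf⟩ := Group.fg_iff.mp (inferInstance : Group.FG Γ)
  induction n with
  | zero => exact ⟨S, hSf, by simp, by rw [hS]; simp⟩
  | succ n ih =>
    obtain ⟨T, hTf, hTl, hT⟩ := ih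
    set L := (⊤ : Subgroup Γ).lowerCentralSeries with hL
    have hanti : L (n + 2) ≤ L (n + 1) := lowerCentralSeries_antitone _ (Nat.le_succ _)
    have hsub : Set.image2 (fun t s => ⁅t, s⁆) T S ⊆ (L (n + 1) : Set Γ) := by
      rintro _ ⟨t, ht, s, -, rfl⟩
      exact commutator_mem_commutator (hTl ht) (mem_top s)
    refine ⟨Set.image2 (fun t s => ⁅t, s⁆) T S, hTf.image2 _ hSf, hsub, ?_⟩
    set K := closure (Set.image2 (fun t s => ⁅t, s⁆) T S) ⊔ L (n + 1 + 1) with hK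
    have hKn : K.Normal :=
      normal_of_lowerCentralSeries_le le_sup_right (sup_le ((closure_le _).mpr hsub) hanti)
    let D : Subgroup Γ := (center (Γ ⧸ K)).comap (QuotientGroup.mk' K)
    have hD : ∀ x : Γ, x ∈ D ↔ ∀ y : Γ, ⁅x, y⁆ ∈ K := by
      intro x
      have key : ∀ y : Γ, (QuotientGroup.mk' K y * QuotientGroup.mk' K x =
          QuotientGroup.mk' K x * QuotientGroup.mk' K y) ↔ ⁅x, y⁆ ∈ K := by
        intro y
        rw [← QuotientGroup.eq_one_iff, eq_comm, ← commutatorElement_eq_one_iff_mul_comm]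
        rfl
      rw [mem_comap, mem_center_iff]
      refine ⟨fun h y => (key y).mp (h _), fun h q => ?_⟩
      obtain ⟨y, rfl⟩ := QuotientGroup.mk'_surjective K q
      exact (key y).mpr (h y)
    have hTD : T ⊆ (D : Set Γ) := by
      intro t ht
      let C : Subgroup Γ := (centralizer {QuotientGroup.mk' K t}).comap (QuotientGroup.mk' K)
      have hC : ∀ y, y ∈ C ↔ ⁅t, y⁆ ∈ K := by
        intro y
        rw [mem_comap, mem_centralizer_singleton_iff, ← QuotientGroup.eq_one_iff, eq_comm,
          ← commutatorElement_eq_one_iff_mul_comm]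
        rfl
      have hSC : closure S ≤ C := by
        rw [closure_le]
        intro s hs
        exact (hC s).mpr
          ((le_sup_left : _ ≤ K) (subset_closure (Set.mem_image2_of_mem ht hs)))
      rw [hS] at hSC
      exact (hD t).mpr fun y => (hC y).mp (hSC (mem_top y))
    have hLD : L (n + 1) ≤ D := fun x hx => (hD x).mpr fun y =>
      (le_sup_right : _ ≤ K) (commutator_mem_commutator hx (mem_top y))
    have hall : L n ≤ D := hT.trans (sup_le ((closure_le _).mpr hTD) hLD)
    exact commutator_le.mpr fun x hx y _ => (hD x).mp (hall hx) y

open Subgroup commutatorElement in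
/-- Adjoining finitely many elements of a term of the lower central series to the next term keeps
the rank finite. -/
theorem Subgroup.exists_hasRankLE_closure_sup {Γ : Type*} [Group Γ] {n r : ℕ}
    (h : ((⊤ : Subgroup Γ).lowerCentralSeries (n + 1)).HasRankLE r) {T : Set Γ} (hT : T.Finite)
    (hTl : T ⊆ ((⊤ : Subgroup Γ).lowerCentralSeries n : Set Γ)) :
    ∃ r', (closure T ⊔ (⊤ : Subgroup Γ).lowerCentralSeries (n + 1)).HasRankLE r' := by
  induction T, hT using Set.Finite.induction_on with
  | empty => exact ⟨r, by simpa using h⟩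
  | @insert a T _ _ ih =>
    obtain ⟨ha, hT'⟩ := Set.insert_subset_iff.mp hTl
    obtain ⟨r', hr'⟩ := ih hT'
    have hN : (closure T ⊔ (⊤ : Subgroup Γ).lowerCentralSeries (n + 1)).Normal :=
      normal_of_lowerCentralSeries_le le_sup_right
        (sup_le ((closure_le _).mpr hT') (lowerCentralSeries_antitone _ (Nat.le_succ _)))
    refine ⟨r' + 1, ?_⟩
    have := hr'.sup_zpowers a
    rwa [Set.insert_eq, closure_union, ← zpowers_eq_closure, sup_assoc, sup_comm]

open Subgroup commutatorElement in
theorem Group.exists_hasRankLE_top_of_isNilpotent (Γ : Type*) [Group Γ] [Group.FG Γ]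
    [Group.IsNilpotent Γ] : ∃ r, (⊤ : Subgroup Γ).HasRankLE r := by
  obtain ⟨c, hc⟩ :=
    Subgroup.nilpotent_iff_lowerCentralSeries.mp (inferInstance : Group.IsNilpotent Γ)
  -- Descending induction along the lower central series, from its trivial term up to `Γ`.
  have key : ∀ j ≤ c, ∃ r, ((⊤ : Subgroup Γ).lowerCentralSeries (c - j)).HasRankLE r := by
    intro j hj
    induction j with
    | zero => exact ⟨0, by rw [Nat.sub_zero, hc]; exact hasRankLE_bot⟩
    | succ j ih =>
      obtain ⟨r, hr⟩ := ih (by omega)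
      obtain ⟨T, hTf, hTl, hT⟩ := exists_finite_lowerCentralSeries_le (Γ := Γ) (c - (j + 1))
      rw [show c - j = c - (j + 1) + 1 by omega] at hr
      obtain ⟨r', hr'⟩ := exists_hasRankLE_closure_sup hr hTf hTl
      exact ⟨r', fun K hK => hr' K (hK.trans hT)⟩
  simpa using key c le_rfl

/-! ### Finitely generated nilpotent profinite groups have finite rank -/

section FiniteRank

variable {G : Type*} [Group G] [TopologicalSpace G] [IsTopologicalGroup G] [CompactSpace G]
  [TotallyDisconnectedSpace G]

/-- The rank of a profinite group can be read off the open subgroups: if these are topologically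
generated by `r` elements, then so are all closed subgroups. For a closed subgroup `H`, the
`r`-tuples in `H` that generate `H` modulo an open normal subgroup `N` form nonempty closed sets,
and by compactness some tuple works for all `N`. -/
theorem exists_topologicalClosure_range_eq {r : ℕ}
    (h : ∀ U : Subgroup G, IsOpen (U : Set G) →
      ∃ f : Fin r → G, (Subgroup.closure (Set.range f)).topologicalClosure = U)
    (H : Subgroup G) (hH : IsClosed (H : Set G)) :
    ∃ f : Fin r → G, (Subgroup.closure (Set.range f)).topologicalClosure = H := by
  let X : OpenNormalSubgroup G → Set (Fin r → G) := fun N =>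
    {f | ∀ i, f i ∈ H} ∩ {f | H ≤ Subgroup.closure (Set.range f) ⊔ N.toSubgroup}
  have hne : ∀ N, (X N).Nonempty := by
    intro N
    have hN : N.toSubgroup.Normal := N.isNormal'
    have hNo : IsOpen (N.toSubgroup : Set G) := N.isOpen'
    obtain ⟨f, hf⟩ := h (H ⊔ N.toSubgroup) (Subgroup.isOpen_mono le_sup_right hNo)
    have hfm : ∀ i, ∃ x ∈ H, ∃ y ∈ N.toSubgroup, x * y = f i := by
      intro i
      have : f i ∈ H ⊔ N.toSubgroup := by
        rw [← hf]
        exact Subgroup.le_topologicalClosure _ (Subgroup.subset_closure ⟨i, rfl⟩)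
      exact Subgroup.mem_sup_of_normal_right.mp this
    choose x hx y hy hxy using hfm
    refine ⟨x, hx, ?_⟩
    have hcl : IsClosed ((Subgroup.closure (Set.range x) ⊔ N.toSubgroup : Subgroup G) : Set G) :=
      Subgroup.isClosed_of_isOpen _ (Subgroup.isOpen_mono le_sup_right hNo)
    refine le_sup_left.trans (hf.symm.le.trans (Subgroup.topologicalClosure_minimal _ ?_ hcl))
    rw [Subgroup.closure_le]
    rintro _ ⟨i, rfl⟩
    rw [← hxy i]
    exact Subgroup.mul_mem_sup (Subgroup.subset_closure ⟨i, rfl⟩) (hy i)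
  have hclosed : ∀ N, IsClosed (X N) := by
    intro N
    have hN : N.toSubgroup.Normal := N.isNormal'
    have hNo : IsOpen (N.toSubgroup : Set G) := N.isOpen'
    refine IsClosed.inter ?_ ?_
    · simp only [Set.ofPred_forall]
      exact isClosed_iInter fun i => hH.preimage (continuous_apply i)
    -- The second condition depends only on the tuple modulo `N`.
    · rw [← isOpen_compl_iff, isOpen_iff_mem_nhds]
      intro f hf
      have hU : {f' : Fin r → G | ∀ i, (f i)⁻¹ * f' i ∈ N.toSubgroup} ∈ nhds f := by
        refine IsOpen.mem_nhds ?_ (fun i => by simp [N.toSubgroup.one_mem])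
        simp only [Set.ofPred_forall]
        exact isOpen_iInter_of_finite fun i =>
          hNo.preimage (continuous_const.mul (continuous_apply i))
      refine Filter.mem_of_superset hU fun f' hf' hle => hf ?_
      change H ≤ Subgroup.closure (Set.range f') ⊔ N.toSubgroup at hle
      change H ≤ Subgroup.closure (Set.range f) ⊔ N.toSubgroup
      refine hle.trans (sup_le ?_ le_sup_right)
      rw [Subgroup.closure_le]
      rintro _ ⟨i, rfl⟩
      have := Subgroup.mul_mem_sup (S := Subgroup.closure (Set.range f))
        (Subgroup.subset_closure ⟨i, rfl⟩) (hf' i)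
      simpa using this
  have hmono : ∀ N N' : OpenNormalSubgroup G, N ≤ N' → X N ⊆ X N' := by
    intro N N' hle
    have hle' : N.toSubgroup ≤ N'.toSubgroup := hle
    exact Set.inter_subset_inter_right _ fun f hf => le_trans hf (sup_le_sup_left hle' _)
  have : Nonempty (OpenNormalSubgroup G) :=
    ⟨(ProfiniteGrp.exist_openNormalSubgroup_sub_open_nhds_of_one isOpen_univ
      (Set.mem_univ (1 : G))).choose⟩
  obtain ⟨f, hf⟩ := IsCompact.nonempty_iInter_of_directed_nonempty_isCompact_isClosed X
    (fun N N' => ⟨N ⊓ N', hmono _ _ inf_le_left, hmono _ _ inf_le_right⟩) hne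
    (fun N => (hclosed N).isCompact) hclosed
  rw [Set.mem_iInter] at hf
  refine ⟨f, le_antisymm (Subgroup.topologicalClosure_minimal _ ?_ hH) ?_⟩
  · rw [Subgroup.closure_le]
    rintro _ ⟨i, rfl⟩
    exact (hf this.some).1 i
  · intro x hx
    change x ∈ closure ((Subgroup.closure (Set.range f) : Subgroup G) : Set G)
    rw [mem_closure_iff]
    intro V hV hxV
    obtain ⟨N, hN⟩ := ProfiniteGrp.exist_openNormalSubgroup_sub_open_nhds_of_one
      (hV.preimage (continuous_const_mul x)) (by simpa using hxV)
    have hNn : N.toSubgroup.Normal := N.isNormal'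
    obtain ⟨y, hy, z, hz, rfl⟩ := Subgroup.mem_sup_of_normal_right.mp ((hf N).2 hx)
    have := hN (N.toSubgroup.inv_mem hz)
    exact ⟨y, by simpa using this, hy⟩

/-- A dense finitely generated subgroup has finite rank as an abstract group, and every open
subgroup is the closure of its intersection with this dense subgroup. -/
theorem hasFiniteRank_of_topologicalClosure_eq_top [Group.IsNilpotent G]
    {S : Finset G} (hS : (Subgroup.closure (S : Set G)).topologicalClosure = ⊤) :
    HasFiniteRank G := by
  classical
  set Γ := Subgroup.closure (S : Set G) with hΓ
  have : Group.FG Γ := (Group.fg_iff_subgroup_fg Γ).mpr ⟨S, rfl⟩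
  obtain ⟨r, hr⟩ := Group.exists_hasRankLE_top_of_isNilpotent Γ
  have hdense : Dense (Γ : Set G) := by
    rw [dense_iff_closure_eq, ← Subgroup.topologicalClosure_coe, hS, Subgroup.coe_top]
  have hopen : ∀ U : Subgroup G, IsOpen (U : Set G) →
      ∃ f : Fin r → G, (Subgroup.closure (Set.range f)).topologicalClosure = U := by
    intro U hU
    obtain ⟨f, hf⟩ := hr (U.subgroupOf Γ) le_top
    refine ⟨fun i => f i, ?_⟩
    have hcl : Subgroup.closure (Set.range fun i => (f i : G)) = U ⊓ Γ := by
      have h1 := congrArg (Subgroup.map Γ.subtype) hf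
      rw [MonoidHom.map_closure, ← Set.range_comp, Subgroup.subgroupOf_map_subtype] at h1
      exact h1
    rw [hcl]
    apply le_antisymm
    · exact Subgroup.topologicalClosure_minimal _ inf_le_left (U.isClosed_of_isOpen hU)
    · exact hdense.open_subset_closure_inter hU
  refine ⟨r, fun H hH => ?_⟩
  obtain ⟨f, hf⟩ := exists_topologicalClosure_range_eq hopen H hH
  refine ⟨Finset.univ.image f, Finset.card_image_le.trans (by simp), ?_⟩
  rwa [Finset.coe_image, Finset.coe_univ, Set.image_univ]

end FiniteRank

/-! ### Independent maximal open subgroups -/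

section Independent

variable {G : Type*} [Group G] [TopologicalSpace G] [IsTopologicalGroup G] [CompactSpace G]

/-- A proper open subgroup of a compact group lies in a maximal subgroup, namely in a proper
overgroup of least index. -/
theorem exists_isCoatom_ge_of_isOpen {U : Subgroup G} (hU : IsOpen (U : Set G)) (hne : U ≠ ⊤) :
    ∃ M : Subgroup G, IsCoatom M ∧ U ≤ M := by
  have hfin : U.FiniteIndex :=
    have := U.quotient_finite_of_isOpen hU
    Subgroup.finiteIndex_of_finite_quotient
  obtain ⟨M, ⟨hMne, hUM⟩, hmin⟩ := WellFounded.has_min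
    (InvImage.wf (fun M : Subgroup G => M.index) Nat.lt_wfRel.wf) {M | M ≠ ⊤ ∧ U ≤ M}
    ⟨U, hne, le_rfl⟩
  have := Subgroup.finiteIndex_of_le hUM
  refine ⟨M, ⟨hMne, fun B hB => ?_⟩, hUM⟩
  by_contra hBne
  exact hmin B ⟨hBne, hUM.trans hB.le⟩ (Subgroup.index_strictAnti hB)

/-- A compact totally disconnected group is topologically finitely generated as soon as some open
subgroup lies in all maximal open subgroups: coset representatives then generate. -/
theorem exists_isCoatom_not_le [TotallyDisconnectedSpace G]
    (hG : ¬ ∃ S : Finset G, (Subgroup.closure (S : Set G)).topologicalClosure = ⊤)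
    {K : Subgroup G} (hK : IsOpen (K : Set G)) :
    ∃ M : Subgroup G, IsOpen (M : Set G) ∧ IsCoatom M ∧ ¬ K ≤ M := by
  classical
  have hfin := K.quotient_finite_of_isOpen hK
  have := Fintype.ofFinite (G ⧸ K)
  let S : Finset G := Finset.univ.image (Quotient.out : G ⧸ K → G)
  have hS : ∀ q : G ⧸ K, q.out ∈ Subgroup.closure (S : Set G) := fun q =>
    Subgroup.subset_closure (by simp [S])
  obtain ⟨x, hx⟩ : ∃ x, x ∉ (Subgroup.closure (S : Set G)).topologicalClosure := by
    by_contra! h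
    exact hG ⟨S, (Subgroup.eq_top_iff' _).mpr h⟩
  set C := (Subgroup.closure (S : Set G)).topologicalClosure with hC
  have hclosed : IsClosed (C : Set G) := Subgroup.isClosed_topologicalClosure _
  have hinf := ProfiniteGrp.closedSubgroup_eq_sInf_open (⟨C, hclosed⟩ : ClosedSubgroup G)
  change C = _ at hinf
  obtain ⟨U, hUo, hCU, hxU⟩ : ∃ U : Subgroup G, IsOpen (U : Set G) ∧ C ≤ U ∧ x ∉ U := by
    by_contra! h
    apply hx
    rw [hinf, Subgroup.mem_sInf]
    exact fun N hN => h N hN.1 hN.2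
  obtain ⟨M, hM, hUM⟩ := exists_isCoatom_ge_of_isOpen hUo (fun h => hxU (h ▸ Subgroup.mem_top x))
  refine ⟨M, Subgroup.isOpen_mono hUM hUo, hM, fun hKM => hM.1 ?_⟩
  rw [Subgroup.eq_top_iff']
  intro g
  have h1 : (g : G ⧸ K).out ∈ M := hUM (hCU (Subgroup.le_topologicalClosure _ (hS _)))
  have h2 : (g : G ⧸ K).out⁻¹ * g ∈ M :=
    hKM (QuotientGroup.eq.mp (QuotientGroup.out_eq' (g : G ⧸ K)))
  simpa using M.mul_mem h1 h2

/-- A nilpotent profinite group that is not topologically finitely generated has a sequence of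
open normal subgroups (maximal ones, in fact) such that an element can be in or out of each of
them independently of the others. -/
theorem exists_independent_seq [TotallyDisconnectedSpace G] [Group.IsNilpotent G]
    (hG : ¬ ∃ S : Finset G, (Subgroup.closure (S : Set G)).topologicalClosure = ⊤) :
    ∃ H : ℕ → Subgroup G, (∀ i, IsOpen (H i : Set G)) ∧ (∀ i, (H i).Normal) ∧
      ∀ S : Set ℕ, ∃ g : G, ∀ i, g ∈ H i ↔ i ∈ S := by
  choose! M hMo hMc hMn using fun K : Subgroup G => exists_isCoatom_not_le hG (K := K)
  -- `K n` is the intersection of the first `n` of the subgroups `M (K i)`.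
  obtain ⟨K, hK0, hKs⟩ : ∃ K : ℕ → Subgroup G, K 0 = ⊤ ∧ ∀ n, K (n + 1) = K n ⊓ M (K n) :=
    ⟨fun n => Nat.rec ⊤ (fun _ U => U ⊓ M U) n, rfl, fun _ => rfl⟩
  have hKo : ∀ n, IsOpen (K n : Set G) := by
    intro n
    induction n with
    | zero => rw [hK0]; exact isOpen_univ
    | succ n ih => rw [hKs]; exact ih.inter (hMo _ ih)
  have hKM : ∀ n, ∀ i < n, K n ≤ M (K i) := by
    intro n
    induction n with
    | zero => intro i hi; omega
    | succ n ih =>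
      intro i hi
      rw [hKs]
      rcases Nat.lt_succ_iff_lt_or_eq.mp hi with h | rfl
      · exact inf_le_left.trans (ih i h)
      · exact inf_le_right
  have hopen : ∀ i, IsOpen (M (K i) : Set G) := fun i => hMo _ (hKo i)
  have hnormal : ∀ i, (M (K i)).Normal := fun i =>
    Subgroup.NormalizerCondition.normal_of_coatom _ Group.normalizerCondition_of_isNilpotent
      (hMc _ (hKo i))
  refine ⟨fun i => M (K i), hopen, hnormal, fun S => ?_⟩
  have hstep : ∀ n, ∃ g : G, ∀ i < n, g ∈ M (K i) ↔ i ∈ S := by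
    intro n
    induction n with
    | zero => exact ⟨1, fun i hi => by omega⟩
    | succ n ih =>
      obtain ⟨g, hg⟩ := ih
      -- Multiplying by an element of `K n` does not affect the first `n` conditions.
      suffices ∃ k ∈ K n, (k * g ∈ M (K n) ↔ n ∈ S) by
        obtain ⟨k, hk, hkn⟩ := this
        refine ⟨k * g, fun i hi => ?_⟩
        rcases Nat.lt_succ_iff_lt_or_eq.mp hi with h | rfl
        · rw [Subgroup.mul_mem_cancel_left _ (hKM n i h hk)]
          exact hg i h
        · exact hkn
      by_cases hgn : g ∈ M (K n) ↔ n ∈ S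
      · exact ⟨1, (K n).one_mem, by rwa [one_mul]⟩
      by_cases hgM : g ∈ M (K n)
      · obtain ⟨k, hk, hkM⟩ := SetLike.not_le_iff_exists.mp (hMn _ (hKo n))
        refine ⟨k, hk, ?_⟩
        rw [Subgroup.mul_mem_cancel_right _ hgM]
        tauto
      · have hn := hnormal n
        have htop : K n ⊔ M (K n) = ⊤ :=
          (hMc _ (hKo n)).2 _ (right_lt_sup.mpr (hMn _ (hKo n)))
        have hmem : g ∈ K n ⊔ M (K n) := htop ▸ Subgroup.mem_top g
        obtain ⟨k, hk, m, hm, rfl⟩ := Subgroup.mem_sup_of_normal_right.mp hmem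
        refine ⟨k⁻¹, (K n).inv_mem hk, ?_⟩
        rw [inv_mul_cancel_left]
        tauto
  have hclopen : ∀ i, IsClosed {g : G | g ∈ M (K i) ↔ i ∈ S} := by
    intro i
    by_cases hi : i ∈ S
    · simpa [hi] using Subgroup.isClosed_of_isOpen _ (hopen i)
    · simp only [hi, iff_false]
      exact (hopen i).isClosed_compl
  obtain ⟨g, hg⟩ := IsCompact.nonempty_iInter_of_sequence_nonempty_isCompact_isClosed
    (fun n => ⋂ i < n, {g : G | g ∈ M (K i) ↔ i ∈ S})
    (fun n => Set.biInter_mono (fun i hi => Nat.lt_succ_of_lt hi) (fun _ _ => subset_rfl))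
    (fun n => by simpa [Set.Nonempty] using hstep n)
    (isClosed_biInter fun i _ => hclopen i).isCompact
    (fun n => isClosed_biInter fun i _ => hclopen i)
  refine ⟨g, fun i => ?_⟩
  have := Set.mem_iInter.mp hg (i + 1)
  exact Set.mem_iInter₂.mp this i (Nat.lt_succ_self i)

end Independent

/-! ### Diagonal isometries of rooted trees -/

section DiagonalIsometry

variable {m : ℕ → ℕ}

/-- Appending a letter to a path from the root. -/
def TreeVertex.snoc (v : TreeVertex m) (a : Fin (m v.1)) : TreeVertex m :=
  ⟨v.1 + 1, Fin.snoc (α := fun i : Fin (v.1 + 1) => Fin (m i)) v.2 a⟩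

theorem TreeVertex.snoc_inj {u v : TreeVertex m} {a : Fin (m u.1)} {b : Fin (m v.1)}
    (h : u.snoc a = v.snoc b) : u = v ∧ HEq a b := by
  obtain ⟨n, u⟩ := u
  obtain ⟨k, v⟩ := v
  obtain rfl : n = k := Nat.succ_injective (congrArg Sigma.fst h)
  have h' : Fin.snoc (α := fun i : Fin (n + 1) => Fin (m i)) u a =
      Fin.snoc (α := fun i : Fin (n + 1) => Fin (m i)) v b := eq_of_heq (Sigma.mk.inj h).2
  obtain ⟨h1, h2⟩ := Fin.snoc_injective2 h'
  exact ⟨by rw [h1], heq_of_eq h2⟩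

/-- Permutations of the letters, one for each level, act on the vertices letter by letter. -/
def diagonalEquiv (σ : ∀ i, Equiv.Perm (Fin (m i))) : Equiv.Perm (TreeVertex m) :=
  Equiv.sigmaCongrRight fun _ => Equiv.piCongrRight fun i => σ i

theorem diagonalEquiv_snoc (σ : ∀ i, Equiv.Perm (Fin (m i))) (v : TreeVertex m)
    (a : Fin (m v.1)) :
    diagonalEquiv σ (v.snoc a) = (diagonalEquiv σ v).snoc (σ v.1 a) := by
  refine Sigma.ext rfl (heq_of_eq (funext fun i => ?_))
  refine Fin.lastCases ?_ (fun j => ?_) i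
  · change σ v.1 (Fin.snoc (α := fun i : Fin (v.1 + 1) => Fin (m i)) v.2 a (Fin.last v.1)) =
      Fin.snoc (α := fun i : Fin (v.1 + 1) => Fin (m i)) (fun i => σ i (v.2 i)) (σ v.1 a)
        (Fin.last v.1)
    rw [Fin.snoc_last, Fin.snoc_last]
  · change σ j (Fin.snoc (α := fun i : Fin (v.1 + 1) => Fin (m i)) v.2 a j.castSucc) =
      Fin.snoc (α := fun i : Fin (v.1 + 1) => Fin (m i)) (fun i => σ i (v.2 i)) (σ v.1 a)
        j.castSucc
    rw [Fin.snoc_castSucc, Fin.snoc_castSucc]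

theorem IsChild.diagonalEquiv (σ : ∀ i, Equiv.Perm (Fin (m i))) {u v : TreeVertex m}
    (h : IsChild m u v) : IsChild m (diagonalEquiv σ u) (diagonalEquiv σ v) := by
  obtain ⟨a, rfl⟩ := h
  exact ⟨σ u.1 a, diagonalEquiv_snoc σ u a⟩

/-- The action of a sequence of permutations of the letters, as a graph automorphism. -/
def diagonalGraphIso (σ : ∀ i, Equiv.Perm (Fin (m i))) : rootedTree m ≃g rootedTree m where
  toEquiv := diagonalEquiv σ
  map_rel_iff' {u v} := by
    have key : ∀ u v, IsChild m (diagonalEquiv σ u) (diagonalEquiv σ v) ↔ IsChild m u v := by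
      refine fun u v => ⟨fun h => ?_, IsChild.diagonalEquiv σ⟩
      have hinv : ∀ w, diagonalEquiv (σ⁻¹) (diagonalEquiv σ w) = w := fun w =>
        Sigma.ext rfl (heq_of_eq (funext fun i => (σ i).symm_apply_apply (w.2 i)))
      simpa only [hinv] using IsChild.diagonalEquiv (σ⁻¹) h
    simp only [rootedTree, SimpleGraph.fromRel_adj, key, ne_eq, EmbeddingLike.apply_eq_iff_eq]

/-- The homomorphism from sequences of permutations of the letters to root-fixing isometries. -/
def diagonalIso (m : ℕ → ℕ) : (∀ i, Equiv.Perm (Fin (m i))) →* treeIso m where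
  toFun σ := ⟨diagonalGraphIso σ, Sigma.ext rfl (heq_of_eq (funext fun i => i.elim0))⟩
  map_one' := rfl
  map_mul' _ _ := rfl

theorem adj_rootedTree_iff {u v : TreeVertex m} :
    (rootedTree m).Adj u v ↔ (∃ a, v = u.snoc a) ∨ ∃ a, u = v.snoc a := by
  rw [rootedTree, SimpleGraph.fromRel_adj]
  refine ⟨fun h => h.2, fun h => ⟨?_, h⟩⟩
  rintro rfl
  rcases h with ⟨a, h⟩ | ⟨a, h⟩ <;> exact absurd (congrArg Sigma.fst h) (Nat.succ_ne_self _).symm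

theorem treeIso_apply_fst (g : treeIso m) (v : TreeVertex m) :
    ((g : rootedTree m ≃g rootedTree m) v).1 = v.1 := by
  suffices H : ∀ n, ∀ (g : treeIso m) (v : TreeVertex m), v.1 = n →
      ((g : rootedTree m ≃g rootedTree m) v).1 = n from H _ g v rfl
  intro n
  induction n using Nat.strong_induction_on with
  | _ n ih =>
    rintro g ⟨k, x⟩ rfl
    cases k with
    | zero =>
      have : (⟨0, x⟩ : TreeVertex m) = treeRoot m :=
        Sigma.ext rfl (heq_of_eq (funext fun i => i.elim0))
      rw [this, show (g : rootedTree m ≃g rootedTree m) (treeRoot m) = treeRoot m from g.2]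
    | succ k =>
      let u : TreeVertex m := ⟨k, Fin.init x⟩
      have huv : (rootedTree m).Adj u ⟨k + 1, x⟩ := by
        refine adj_rootedTree_iff.mpr (Or.inl ⟨x (Fin.last k), ?_⟩)
        exact Sigma.ext rfl (heq_of_eq (Fin.snoc_init_self x).symm)
      have hu := ih k (Nat.lt_succ_self k) g u rfl
      rcases adj_rootedTree_iff.mp ((g : rootedTree m ≃g rootedTree m).map_adj_iff.mpr huv) with
        ⟨a, h⟩ | ⟨a, h⟩
      · rw [h]
        exact congrArg Nat.succ hu
      -- An isometry moving the vertex up would have an inverse moving a vertex down.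
      · have h1 := (congrArg Sigma.fst h).symm.trans hu
        have h2 := ih _ (Nat.lt_succ_of_le (Nat.le_of_succ_le h1.le)) g⁻¹ _ rfl
        have h3 : ((g⁻¹ : treeIso m) : rootedTree m ≃g rootedTree m)
            ((g : rootedTree m ≃g rootedTree m) ⟨k + 1, x⟩) = ⟨k + 1, x⟩ :=
          (g : rootedTree m ≃g rootedTree m).symm_apply_apply _
        rw [h3] at h2
        exact h2.symm

/-- The isometry `g` fixes all neighbours of its fixed vertices of level `n`. -/
def FixesNeighbors (n : ℕ) (g : treeIso m) : Prop :=
  ∀ v w : TreeVertex m, v.1 = n → (rootedTree m).Adj v w →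
    (g : rootedTree m ≃g rootedTree m) v = v → (g : rootedTree m ≃g rootedTree m) w = w

theorem FixesNeighbors.of_isConj {n : ℕ} {g h : treeIso m} (hg : FixesNeighbors n g)
    (hgh : IsConj g h) : FixesNeighbors n h := by
  obtain ⟨c, rfl⟩ := isConj_iff.mp hgh.symm
  intro v w hv hvw hfix
  let c' : rootedTree m ≃g rootedTree m := c
  have key : ∀ x, (h : rootedTree m ≃g rootedTree m) x = x →
      ((c * h * c⁻¹ : treeIso m) : rootedTree m ≃g rootedTree m) (c' x) = c' x := by
    intro x hx
    change c' ((h : rootedTree m ≃g rootedTree m) (c'.symm (c' x))) = c' x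
    rw [c'.symm_apply_apply, hx]
  have h1 := hg (c' v) (c' w) ((treeIso_apply_fst c v).trans hv) (c'.map_adj_iff.mpr hvw)
    (key v hfix)
  change c' ((h : rootedTree m ≃g rootedTree m) (c'.symm (c' w))) = c' w at h1
  rw [c'.symm_apply_apply] at h1
  exact c'.injective h1

theorem fixesNeighbors_diagonalIso_iff {σ : ∀ i, Equiv.Perm (Fin (m i))}
    (hσ : ∀ i, ∃ x, σ i x = x) (n : ℕ) :
    FixesNeighbors n (diagonalIso m σ) ↔ σ n = 1 := by
  constructor
  · intro h
    choose x hx using hσ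
    let v : TreeVertex m := ⟨n, fun i => x i⟩
    have hv : diagonalEquiv σ v = v := Sigma.ext rfl (heq_of_eq (funext fun i => hx i))
    refine Equiv.ext fun a => ?_
    have h1 : diagonalEquiv σ (v.snoc a) = v.snoc a :=
      h v (v.snoc a) rfl (adj_rootedTree_iff.mpr (Or.inl ⟨a, rfl⟩)) hv
    rw [diagonalEquiv_snoc] at h1
    exact eq_of_heq (TreeVertex.snoc_inj h1).2
  · rintro h v w rfl hvw hv
    change diagonalEquiv σ v = v at hv
    change diagonalEquiv σ w = w
    rcases adj_rootedTree_iff.mp hvw with ⟨a, rfl⟩ | ⟨a, rfl⟩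
    · have hv2 := eq_of_heq (Sigma.mk.inj hv).2
      refine (diagonalEquiv_snoc σ v a).trans ?_
      rw [h]
      exact congrArg (fun y => TreeVertex.snoc ⟨v.1, y⟩ a) hv2
    · rw [diagonalEquiv_snoc] at hv
      exact (TreeVertex.snoc_inj hv).1

/-- If all letter permutations have fixed points, then the conjugacy class of a diagonal isometry
shows which of them are trivial. -/
theorem eq_one_iff_of_isConj_diagonalIso {σ τ : ∀ i, Equiv.Perm (Fin (m i))}
    (hσ : ∀ i, ∃ x, σ i x = x) (hτ : ∀ i, ∃ x, τ i x = x)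
    (h : IsConj (diagonalIso m σ) (diagonalIso m τ)) (n : ℕ) : σ n = 1 ↔ τ n = 1 := by
  rw [← fixesNeighbors_diagonalIso_iff hσ, ← fixesNeighbors_diagonalIso_iff hτ]
  exact ⟨fun hn => hn.of_isConj h, fun hn => hn.of_isConj h.symm⟩

end DiagonalIsometry

/-! ### Representations with many isometry types -/

section Representation

/-- Independence of the subgroups `H i` yields an element for each set of natural numbers, and these
elements have pairwise non-conjugate images. -/
theorem not_hasSmallNumberOfTypes_of_independent {G : Type*} [Group G] {Γ : Type} [Group Γ]
    (ρ : G →* Γ) {H : ℕ → Subgroup G} (hρ : ∀ g h : G, IsConj (ρ g) (ρ h) → ∀ i, g ∈ H i ↔ h ∈ H i)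
    (hH : ∀ S : Set ℕ, ∃ g : G, ∀ i, g ∈ H i ↔ i ∈ S) : ¬ HasSmallNumberOfTypes ρ.range := by
  choose g hg using hH
  refine not_lt.mpr ?_
  rw [← Cardinal.mk_set_nat]
  refine Cardinal.mk_le_of_injective
    (f := fun S => ⟨ConjClasses.mk (ρ (g S)), ρ (g S), ⟨g S, rfl⟩, rfl⟩) fun S T hST => ?_
  have hconj : IsConj (ρ (g S)) (ρ (g T)) :=
    ConjClasses.mk_eq_mk_iff_isConj.mp (Subtype.mk.inj hST)
  ext i
  rw [← hg S, ← hg T]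
  exact hρ _ _ hconj i

variable {G : Type*} [Group G] [TopologicalSpace G] [IsTopologicalGroup G] [CompactSpace G]

/-- A sequence of open normal subgroups `L i` of a compact group gives a representation on a tree
whose isometry types record which of the `L i` an element belongs to. The letters of level `i` are
the cosets of `L i` together with one additional fixed letter, which keeps vertices fixed by the
whole group on all levels. -/
theorem exists_rep_of_seq (L : ℕ → Subgroup G) (ho : ∀ i, IsOpen (L i : Set G))
    (hn : ∀ i, (L i).Normal) :
    ∃ m : ℕ → ℕ, (∀ i, 0 < m i) ∧ ∃ ρ : G →* treeIso m, Continuous ρ ∧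
      ∀ g h : G, IsConj (ρ g) (ρ h) → ∀ i, g ∈ L i ↔ h ∈ L i := by
  have hfin : ∀ i, Finite (G ⧸ L i) := fun i => (L i).quotient_finite_of_isOpen (ho i)
  let m : ℕ → ℕ := fun i => Nat.card (Option (G ⧸ L i))
  let e : ∀ i, Option (G ⧸ L i) ≃ Fin (m i) := fun i => Finite.equivFin _
  let φ : ∀ i, G →* Equiv.Perm (Fin (m i)) := fun i =>
    (e i).permCongrHom.toMonoidHom.comp (MulAction.toPermHom G (Option (G ⧸ L i)))
  have hφ : ∀ i g x, φ i g (e i x) = e i (g • x) := fun i g x => by simp [φ]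
  have hfix : ∀ g i, ∃ x, φ i g x = x := fun g i => ⟨e i none, by rw [hφ]; rfl⟩
  have hone : ∀ i g, φ i g = 1 ↔ g ∈ L i := by
    intro i g
    constructor
    · intro h
      have h1 := hφ i g (some ((1 : G) : G ⧸ L i))
      rw [h, Equiv.Perm.one_apply, (e i).apply_eq_iff_eq] at h1
      have h2 : ((1 : G) : G ⧸ L i) = ((g * 1 : G) : G ⧸ L i) := Option.some_injective _ h1
      rw [QuotientGroup.eq] at h2
      simpa using h2
    · intro h
      refine Equiv.ext fun y => ?_
      obtain ⟨x, rfl⟩ := (e i).surjective y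
      rw [hφ, Equiv.Perm.one_apply, (e i).apply_eq_iff_eq]
      rcases x with _ | q
      · rfl
      · obtain ⟨x, rfl⟩ := QuotientGroup.mk_surjective q
        refine congrArg some (QuotientGroup.eq.mpr ?_)
        have := (hn i).conj_mem _ ((L i).inv_mem h) x⁻¹
        simpa [mul_assoc] using this
  refine ⟨m, fun i => Nat.card_pos, (diagonalIso m).comp (MonoidHom.mk' (fun g i => φ i g)
    fun g h => funext fun i => map_mul (φ i) g h), ?_, ?_⟩
  · refine continuous_induced_rng.mpr (@continuous_pi _ _ _ _ (fun _ => ⊥) _ fun v => ?_)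
    -- The target is discrete, so continuity means that each vertex has a locally constant image.
    let _ : TopologicalSpace (TreeVertex m) := ⊥
    refine continuous_iff_continuousAt.mpr fun g => ?_
    refine ContinuousAt.congr (f := fun _ => diagonalEquiv (fun i => φ i g) v)
      continuousAt_const ?_
    have hU : {h : G | ∀ i : Fin v.1, g⁻¹ * h ∈ L i} ∈ nhds g := by
      refine IsOpen.mem_nhds ?_ (fun i => by simp [(L i).one_mem])
      simp only [Set.ofPred_forall]
      exact isOpen_iInter_of_finite fun i => (ho i).preimage (continuous_const_mul g⁻¹)
    filter_upwards [hU] with h hh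
    refine Sigma.ext rfl (heq_of_eq (funext fun i => ?_))
    have h1 : φ i h = φ i g := by
      rw [← mul_inv_cancel_left g h, map_mul, (hone i _).mpr (hh i), mul_one]
    change φ i g (v.2 i) = φ i h (v.2 i)
    rw [h1]
  · intro g h hgh i
    rw [← hone, ← hone]
    exact eq_one_iff_of_isConj_diagonalIso (hfix g) (hfix h) hgh i

theorem exists_seq_openNormal_iInf_eq_bot [T2Space G] [TotallyDisconnectedSpace G]
    [SecondCountableTopology G] :
    ∃ N : ℕ → Subgroup G, (∀ i, IsOpen (N i : Set G)) ∧ (∀ i, (N i).Normal) ∧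
      ∀ g, (∀ i, g ∈ N i) → g = 1 := by
  obtain ⟨U, hU⟩ := (nhds (1 : G)).exists_antitone_basis
  have key : ∀ i, ∃ N : OpenNormalSubgroup G, (N : Set G) ⊆ interior (U i) := fun i =>
    ProfiniteGrp.exist_openNormalSubgroup_sub_open_nhds_of_one isOpen_interior
      (mem_interior_iff_mem_nhds.mpr (hU.mem i))
  choose N hN using key
  refine ⟨fun i => (N i).toSubgroup, fun i => (N i).isOpen', fun i => (N i).isNormal', ?_⟩
  intro g hg
  by_contra hne
  obtain ⟨i, hi⟩ := hU.mem_iff.mp (isOpen_compl_singleton.mem_nhds (Ne.symm hne))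
  exact hi (interior_subset (hN i (hg i))) rfl

end Representation

/-! ### Representations with few isometry types -/

theorem mainTheorem2 {G : Type*} [Group G] [TopologicalSpace G] [IsTopologicalGroup G]
    [CompactSpace G] [T2Space G] [TotallyDisconnectedSpace G] (hG : Group.IsNilpotent G) :
    ((∀ m : ℕ → ℕ, (∀ i, 0 < m i) → ∀ ρ : G →* treeIso m, Continuous ρ →
        HasSmallNumberOfTypes ρ.range) →
      HasFiniteRank G) ∧
    (SecondCountableTopology G →
      (∀ m : ℕ → ℕ, (∀ i, 0 < m i) → ∀ ρ : G →* treeIso m, Continuous ρ →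
        Function.Injective ρ → HasSmallNumberOfTypes ρ.range) →
      HasFiniteRank G) := by
  by_cases hfg : ∃ S : Finset G, (Subgroup.closure (S : Set G)).topologicalClosure = ⊤
  · obtain ⟨S, hS⟩ := hfg
    have := hasFiniteRank_of_topologicalClosure_eq_top hS
    exact ⟨fun _ => this, fun _ _ => this⟩
  obtain ⟨H, hHo, hHn, hH⟩ := exists_independent_seq hfg
  constructor
  · intro hsmall
    obtain ⟨m, hm, ρ, hρc, hρ⟩ := exists_rep_of_seq H hHo hHn
    exact absurd (hsmall m hm ρ hρc) (not_hasSmallNumberOfTypes_of_independent ρ hρ hH)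
  · intro _ hsmall
    obtain ⟨N, hNo, hNn, hN⟩ := exists_seq_openNormal_iInf_eq_bot (G := G)
    -- Interleaving with subgroups of trivial intersection makes the representation faithful.
    let L : ℕ ⊕ ℕ → Subgroup G := Sum.elim H N
    let e : ℕ ≃ ℕ ⊕ ℕ := Equiv.natSumNatEquivNat.symm
    obtain ⟨m, hm, ρ, hρc, hρ⟩ := exists_rep_of_seq (fun i => L (e i))
      (fun i => by rcases e i with j | j; exacts [hHo j, hNo j])
      (fun i => by rcases e i with j | j; exacts [hHn j, hNn j])
    have hL : ∀ g h : G, IsConj (ρ g) (ρ h) → ∀ j, g ∈ L j ↔ h ∈ L j := fun g h hgh j => by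
      simpa using hρ g h hgh (e.symm j)
    have hinj : Function.Injective ρ := by
      refine (injective_iff_map_eq_one ρ).mpr fun g hg => hN g fun i => ?_
      have hconj : IsConj (ρ g) (ρ 1) := by rw [hg, map_one]
      exact (hL g 1 hconj (Sum.inr i)).mpr (N i).one_mem
    exact absurd (hsmall m hm ρ hρc hinj) (not_hasSmallNumberOfTypes_of_independent ρ
      (fun g h hgh i => hL g h hgh (Sum.inl i)) hH)
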